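/- Let $X$ be a normal topological space (any two disjoint closed subsets have disjoint neighborhoods) whose Lebesgue covering dimension is a finite number $d$; here the covering dimension is the smallest $d\in\mathbb{N}$ such that every open covering of $X$ has an open refinement for which each point of $X$ lies in at most $d+1$ members. Define $$\gamma=\begin{cases}0 & \text{if } d\le 1,\\ 1 & \text{if } 2\le d\le 3,\\ \lceil d/2\rceil & \text{if } d\ge 4.\end{cases}$$ Let $\xi$ be a locally trivial complex vector bundle over $X$ (its rank need not be constant) which is of finite type, that is, $X$ has a finite open covering such that $\xi$ is trivial over each of its members. Let $b$ be a natural number such that $\dim_{\mathbb{C}}\xi_x\ge b$ for all $x\in X$. If $b\ge\gamma+1$, then $\xi$ has a trivial summand of rank $b-\gamma$: there is a complex vector bundle $\eta$ over $X$ such that $\xi\cong(X\times\mathbb{C}^{b-\gamma})\oplus\eta$. In other words, $\xi$ has continuous cross-sections $s_1,\ldots,s_{b-\gamma}$ such that for all $x\in X$ the vectors $s_1(x),\ldots,s_{b-\gamma}(x)$ are linearly independent. -/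

import Mathlib

universe u v

/-- `X` has (Lebesgue covering) dimension at most `d`: every open covering of `X` has an open
refinement such that every point of `X` belongs to at most `d + 1` of its members. -/
def HasCoveringDimLE (X : Type u) [TopologicalSpace X] (d : ℕ) : Prop :=
  ∀ 𝒰 : Set (Set X), (∀ U ∈ 𝒰, IsOpen U) → ⋃₀ 𝒰 = Set.univ →
    ∃ 𝒱 : Set (Set X), (∀ V ∈ 𝒱, IsOpen V) ∧ ⋃₀ 𝒱 = Set.univ ∧
      (∀ V ∈ 𝒱, ∃ U ∈ 𝒰, V ⊆ U) ∧
      ∀ x : X, {V : Set X | V ∈ 𝒱 ∧ x ∈ V}.encard ≤ (d : ℕ∞) + 1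

/-- The Lebesgue covering dimension: the smallest `d` such that `X` has dimension at most `d`,
and `⊤` if there is none. -/
noncomputable def coveringDim (X : Type u) [TopologicalSpace X] : ℕ∞ :=
  ⨅ (d : ℕ) (_ : HasCoveringDimLE X d), (d : ℕ∞)

/-- A family `E` of complex vector spaces over `X`, with a topology on its total space, is trivial
over `U`: for some `n`, there is a fiberwise linear homeomorphism over `U` from the part of the
total space above `U` to `U × ℂⁿ`. (The set `U` is then open, and the fibers over `U` have
dimension `n`.) -/
def IsTrivialBundleOn {X : Type u} [TopologicalSpace X] (E : X → Type v)
    [∀ x, AddCommGroup (E x)] [∀ x, Module ℂ (E x)] [TopologicalSpace (Σ x, E x)]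
    (U : Set X) : Prop :=
  ∃ (n : ℕ) (e : Bundle.Trivialization (Fin n → ℂ) (Sigma.fst : (Σ x, E x) → X)),
    e.baseSet = U ∧ ∀ x ∈ U, IsLinearMap ℂ (fun v : E x => (e ⟨x, v⟩).2)

/-- A (locally trivial) complex vector bundle over `X`. The dimension of the fibers is finite and
locally constant, but it is not required to be constant. -/
structure ComplexVectorBundle (X : Type u) [TopologicalSpace X] where
  /-- The fibers. -/
  Fiber : X → Type v
  [addCommGroup : ∀ x, AddCommGroup (Fiber x)]
  [module : ∀ x, Module ℂ (Fiber x)]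
  /-- The topology of the total space. -/
  [topTotal : TopologicalSpace (Σ x, Fiber x)]
  locallyTrivial : ∀ x : X, ∃ U : Set X, x ∈ U ∧ IsTrivialBundleOn Fiber U

namespace ComplexVectorBundle

attribute [instance] ComplexVectorBundle.addCommGroup ComplexVectorBundle.module

variable {X : Type u} [TopologicalSpace X]

/-- The total space. -/
def Total (ξ : ComplexVectorBundle.{u, v} X) : Type (max u v) := Σ x, ξ.Fiber x

instance (ξ : ComplexVectorBundle.{u, v} X) : TopologicalSpace ξ.Total := ξ.topTotal

/-- The point `v` of the fiber over `x`, as a point of the total space. -/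
def point (ξ : ComplexVectorBundle.{u, v} X) (x : X) (v : ξ.Fiber x) : ξ.Total := ⟨x, v⟩

/-- `ξ` is trivial over `U`, that is, isomorphic over `U` to `U × ℂⁿ` for some `n`. -/
def IsTrivialOn (ξ : ComplexVectorBundle.{u, v} X) (U : Set X) : Prop :=
  letI := ξ.topTotal
  IsTrivialBundleOn ξ.Fiber U

/-- `ξ` is of finite type: there is a finite open covering of the base space such that `ξ` is
trivial over each of its members. -/
def IsFiniteType (ξ : ComplexVectorBundle.{u, v} X) : Prop :=
  ∃ 𝒰 : Set (Set X), 𝒰.Finite ∧ (∀ U ∈ 𝒰, IsOpen U) ∧ ⋃₀ 𝒰 = Set.univ ∧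
    ∀ U ∈ 𝒰, ξ.IsTrivialOn U

/-- `ξ` has a trivial summand of rank `r`: it is isomorphic to the direct sum `(X × ℂʳ) ⊕ η`
for some vector bundle `η` over `X`. The fiber of this direct sum over `x` is `ℂʳ × ηₓ`; its total
space, the fiber product over `X` of `X × ℂʳ` and the total space of `η`, is the product of `ℂʳ`
and the total space of `η`. -/
def HasTrivialSummand (ξ : ComplexVectorBundle.{u, v} X) (r : ℕ) : Prop :=
  ∃ (η : ComplexVectorBundle.{u, v} X) (Φ : ξ.Total ≃ₜ (Fin r → ℂ) × η.Total)
    (φ : ∀ x, ξ.Fiber x ≃ₗ[ℂ] (Fin r → ℂ) × η.Fiber x),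
    ∀ (x : X) (v : ξ.Fiber x), Φ (ξ.point x v) = ((φ x v).1, η.point x (φ x v).2)

/-- `s` is a (continuous) cross-section of `ξ`. -/
def IsSection (ξ : ComplexVectorBundle.{u, v} X) (s : ∀ x, ξ.Fiber x) : Prop :=
  Continuous fun x => ξ.point x (s x)

end ComplexVectorBundle

/-- `γ = 0` if `d ≤ 1`, `γ = 1` if `2 ≤ d ≤ 3`, and `γ = ⌈d / 2⌉` if `d ≥ 4`. -/
noncomputable def summandDefect (d : ℕ) : ℕ :=
  if d ≤ 1 then 0 else if d ≤ 3 then 1 else ⌈(d : ℝ) / 2⌉₊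

/-! Since `d ≤ 2γ + 1`, there is room to build a frame one section at a time. If `σ` embeds the
trivial bundle of rank `k` in `ξ` and all fibers have rank at least `k + 1 + γ`, the quotient by the
image of `σ` has real rank at least `2γ + 2 > d`. A section of such a quotient can be kept away from
zero: maps from a closed subset to a punctured real vector space of dimension greater than `d`
extend (`HasCoveringDimLE.exists_continuous_ne_zero_eqOn`, by general position).
`exists_continuous_section_notMem_range` applies this on finitely many closed pieces lying in charts
adapted to `σ`, and `exists_trivial_subbundle` iterates. The resulting embedding splits: local
retractions are averaged by a partition of unity (`exists_retraction`), and the kernel of the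
retraction is the complementary bundle `η`. -/

open Set Topology

/-! ### General position in real vector spaces -/

section GeneralPosition

variable {E : Type*} [NormedAddCommGroup E] [NormedSpace ℝ E] [FiniteDimensional ℝ E]

/-- Finitely many proper subspaces do not cover any ball. -/
theorem exists_dist_lt_forall_notMem_submodule {κ : Type*} [Finite κ] (W : κ → Submodule ℝ E)
    (hW : ∀ k, W k ≠ ⊤) (q : E) {ε : ℝ} (hε : 0 < ε) :
    ∃ y : E, dist y q < ε ∧ ∀ k, y ∉ W k := by
  have hd : Dense (⋂ k, ((W k : Set E)ᶜ)) := by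
    refine dense_iInter_of_isOpen (fun k => ?_) (fun k => ?_)
    · exact (Submodule.closed_of_finiteDimensional (W k)).isOpen_compl
    · rw [← interior_eq_empty_iff_dense_compl]
      by_contra h
      exact hW k ((W k).eq_top_of_nonempty_interior' (nonempty_iff_ne_empty.2 h))
  obtain ⟨y, hy, hyq⟩ := hd.exists_dist_lt q hε
  exact ⟨y, by rwa [dist_comm], fun k => by simpa using mem_iInter.1 hy k⟩

/-- Any finite family of points can be moved slightly into general linear position. -/
theorem exists_dist_lt_forall_linearIndepOn {ι : Type*} [Finite ι] (q : ι → E) {ε : ℝ}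
    (hε : 0 < ε) {N : ℕ} (hN : N ≤ Module.finrank ℝ E) :
    ∃ p : ι → E, (∀ i, dist (p i) (q i) < ε) ∧
      ∀ S : Finset ι, S.card ≤ N → LinearIndepOn ℝ p (S : Set ι) := by
  classical
  have := Fintype.ofFinite ι
  suffices H : ∀ T : Finset ι, ∃ p : ι → E, (∀ i, dist (p i) (q i) < ε) ∧
      ∀ S ⊆ T, S.card ≤ N → LinearIndepOn ℝ p (S : Set ι) by
    obtain ⟨p, hp, h⟩ := H Finset.univ
    exact ⟨p, hp, fun S hS => h S (Finset.subset_univ S) hS⟩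
  intro T
  induction T using Finset.induction_on with
  | empty =>
    refine ⟨q, fun i => by simpa using hε, fun S hS _ => ?_⟩
    rw [Finset.subset_empty.1 hS, Finset.coe_empty]
    exact linearIndepOn_empty ℝ q
  | insert a T ha ih =>
    obtain ⟨p, hp, hpT⟩ := ih
    -- The new point has to avoid the finitely many spans of fewer than `N` points. Each has
    -- dimension below `N ≤ finrank`, hence is proper.
    obtain ⟨y, hyq, hy⟩ := exists_dist_lt_forall_notMem_submodule
      (κ := {S : Finset ι // S.card < N}) (fun S => Submodule.span ℝ (p '' (S.1 : Set ι)))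
      (fun S h => by
        have h1 : (S.1.image p).card ≤ S.1.card := Finset.card_image_le
        have h2 := finrank_span_finset_le_card (R := ℝ) (S.1.image p)
        rw [Finset.coe_image, Set.finrank, h, finrank_top] at h2
        have := S.2
        omega) (q a) hε
    refine ⟨Function.update p a y, fun i => ?_, fun S hS hSN => ?_⟩
    · rcases eq_or_ne i a with rfl | h
      · simpa using hyq
      · simpa [h] using hp i
    have key : ∀ S' ⊆ T, EqOn p (Function.update p a y) (S' : Set ι) := fun S' hS' i hi => by
      have : i ≠ a := fun h => ha (h ▸ hS' hi)
      simp [this]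
    by_cases haS : a ∈ S
    · obtain ⟨S', haS', rfl⟩ : ∃ S', a ∉ S' ∧ insert a S' = S :=
        ⟨S.erase a, Finset.notMem_erase a S, Finset.insert_erase haS⟩
      have hS'T : S' ⊆ T := fun i hi =>
        (Finset.mem_insert.1 (hS (Finset.mem_insert_of_mem hi))).resolve_left
          (fun h => haS' (h ▸ hi))
      rw [Finset.card_insert_of_notMem haS'] at hSN
      rw [Finset.coe_insert, linearIndepOn_insert (by simpa using haS')]
      refine ⟨(hpT S' hS'T (by omega)).congr (key S' hS'T), ?_⟩
      rw [← (key S' hS'T).image_eq, Function.update_self]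
      exact hy ⟨S', by omega⟩
    · have hST : S ⊆ T := fun i hi =>
        (Finset.mem_insert.1 (hS hi)).resolve_left (fun h => haS (h ▸ hi))
      exact (hpT S hST hSN).congr (key S hST)

end GeneralPosition

/-! ### Covering dimension and extension of nowhere zero maps -/

section CoveringDimension

variable {X : Type u} [TopologicalSpace X] {d : ℕ}

/-- An infimum below `d + 1` is witnessed by some `d' ≤ d`, and the bound on the order is monotone
in the dimension. -/
theorem hasCoveringDimLE_of_coveringDim_eq (h : coveringDim X = (d : ℕ∞)) :
    HasCoveringDimLE X d := by
  have h1 : coveringDim X < ((d + 1 : ℕ) : ℕ∞) := by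
    rw [h]; exact_mod_cast Nat.lt_succ_self d
  simp only [coveringDim, iInf_lt_iff] at h1
  obtain ⟨d', hd', hlt⟩ := h1
  have hle : d' ≤ d := Nat.lt_succ_iff.1 (by exact_mod_cast hlt)
  intro 𝒰 ho hc
  obtain ⟨𝒱, h1, h2, h3, h4⟩ := hd' 𝒰 ho hc
  refine ⟨𝒱, h1, h2, h3, fun x => (h4 x).trans ?_⟩
  gcongr

/-- An open covering of a space of covering dimension at most `d` has a refinement of order at
most `d + 1` with the same index set. -/
theorem HasCoveringDimLE.exists_indexed_refinement (h : HasCoveringDimLE X d) {ι : Type*}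
    (U : ι → Set X) (hU : ∀ i, IsOpen (U i)) (hc : ⋃ i, U i = univ) :
    ∃ V : ι → Set X, (∀ i, IsOpen (V i)) ∧ ⋃ i, V i = univ ∧ (∀ i, V i ⊆ U i) ∧
      ∀ x, {i | x ∈ V i}.encard ≤ (d : ℕ∞) + 1 := by
  obtain ⟨𝒱, ho, hcov, href, hord⟩ := h (range U) (by rintro _ ⟨i, rfl⟩; exact hU i)
    (by rw [sUnion_range, hc])
  have : ∀ V : 𝒱, ∃ i, (V : Set X) ⊆ U i := fun V => by
    obtain ⟨_, ⟨i, rfl⟩, hi⟩ := href V V.2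
    exact ⟨i, hi⟩
  choose r hr using this
  -- Members assigned to the same index are merged, which cannot raise the order: the indices at `x`
  -- are images under `r` of the members at `x`.
  refine ⟨fun i => ⋃ V : {V : 𝒱 // r V = i}, (V.1 : Set X),
    fun i => isOpen_iUnion fun V => ho _ V.1.2, ?_, ?_, fun x => ?_⟩
  · refine eq_univ_of_forall fun x => ?_
    obtain ⟨V, hV, hx⟩ := mem_sUnion.1 (hcov.ge (mem_univ x))
    exact mem_iUnion.2 ⟨r ⟨V, hV⟩, mem_iUnion.2 ⟨⟨⟨V, hV⟩, rfl⟩, hx⟩⟩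
  · rintro i
    refine iUnion_subset ?_
    rintro ⟨V, rfl⟩
    exact hr V
  · refine le_trans ?_ (hord x)
    have hsub : {i | x ∈ ⋃ V : {V : 𝒱 // r V = i}, (V.1 : Set X)} ⊆
        r '' {V : 𝒱 | x ∈ (V : Set X)} := by
      intro i hi
      obtain ⟨V, hV⟩ := mem_iUnion.1 hi
      exact ⟨V.1, hV, V.2⟩
    refine (encard_le_encard hsub).trans ((encard_image_le _ _).trans ?_)
    rw [← Subtype.val_injective.encard_image]
    refine encard_le_encard ?_
    rintro _ ⟨V, hV, rfl⟩
    exact ⟨V.2, hV⟩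

variable {E : Type w} [NormedAddCommGroup E] [NormedSpace ℝ E] [FiniteDimensional ℝ E]

theorem exists_continuous_eqOn_of_isClosed [NormalSpace X] {Y : Type w} [TopologicalSpace Y]
    [TietzeExtension.{u} Y] {D : Set X} (hD : IsClosed D) {f : X → Y} (hf : ContinuousOn f D) :
    ∃ g : X → Y, Continuous g ∧ EqOn g f D := by
  obtain ⟨g, hg⟩ := ContinuousMap.exists_restrict_eq hD ⟨D.domRestrict f, hf.domRestrict⟩
  exact ⟨g, g.continuous, fun x hx => DFunLike.congr_fun hg ⟨x, hx⟩⟩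

/-- A bounded map to a vector space of dimension larger than the covering dimension is uniformly
close to a map without zeros. -/
theorem HasCoveringDimLE.exists_continuous_ne_zero_dist_lt [NormalSpace X]
    (h : HasCoveringDimLE X d) (hE : d < Module.finrank ℝ E) {f : X → E} (hf : Continuous f)
    (hb : Bornology.IsBounded (range f)) {ε : ℝ} (hε : 0 < ε) :
    ∃ g : X → E, Continuous g ∧ (∀ x, g x ≠ 0) ∧ ∀ x, dist (g x) (f x) < ε := by
  classical
  have hε2 : 0 < ε / 2 := half_pos hε
  have := FiniteDimensional.proper ℝ E
  obtain ⟨t, htf, ht⟩ := Metric.totallyBounded_iff.1 (hb.isCompact_closure.totallyBounded.subset subset_closure) (ε / 2) hε2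
  have := htf.to_subtype
  have := Fintype.ofFinite t
  obtain ⟨V, hVo, hVc, hVs, hVd⟩ := h.exists_indexed_refinement
    (fun i : t => f ⁻¹' Metric.ball (i : E) (ε / 2)) (fun i => Metric.isOpen_ball.preimage hf)
    (eq_univ_of_forall fun x => by
      obtain ⟨y, hy, hxy⟩ := mem_iUnion₂.1 (ht (mem_range_self x))
      exact mem_iUnion.2 ⟨⟨y, hy⟩, hxy⟩)
  -- At most `d + 1` coefficients of the partition of unity are nonzero at a point. With any `d + 1`
  -- of the `p i` independent, a vanishing combination would force all coefficients to be zero, yet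
  -- they sum to 1.
  obtain ⟨p, hpd, hpi⟩ := exists_dist_lt_forall_linearIndepOn (fun i : t => (i : E)) hε2
    (N := d + 1) hE
  obtain ⟨φ, hφ⟩ := PartitionOfUnity.exists_isSubordinate_of_locallyFinite isClosed_univ V hVo
    (locallyFinite_of_finite V) hVc.ge
  have hφV : ∀ i x, φ i x ≠ 0 → x ∈ V i := fun i x hx => hφ i (subset_tsupport _ hx)
  have hsum : ∀ x, ∑ i, φ i x = 1 := fun x => by
    rw [← finsum_eq_sum_of_fintype]; exact φ.sum_eq_one (mem_univ x)
  refine ⟨fun x => ∑ i, φ i x • p i, by fun_prop, fun x hx => ?_, fun x => ?_⟩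
  · set S : Finset t := Finset.univ.filter fun i => φ i x ≠ 0
    have hS : S.card ≤ d + 1 := by
      have h1 : (S : Set t) ⊆ {i | x ∈ V i} := fun i hi => hφV i x (by simpa [S] using hi)
      have h2 := (encard_le_encard h1).trans (hVd x)
      rw [encard_coe_eq_coe_finsetCard] at h2
      exact_mod_cast h2
    have h0 : ∑ i ∈ S, φ i x • p i = 0 := by
      rw [← hx]
      refine Finset.sum_subset (Finset.subset_univ _) fun i _ hi => ?_
      have : φ i x = 0 := by simpa [S] using hi
      simp [this]
    have hz := linearIndepOn_finset_iff.1 (hpi S hS) (fun i => φ i x) h0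
    have : ∑ i, φ i x = 0 := Finset.sum_eq_zero fun i _ => by
      by_contra hi
      exact hi (hz i (by simpa [S] using hi))
    rw [hsum x] at this
    exact one_ne_zero this
  · beta_reduce
    rw [← finsum_eq_sum_of_fintype, ← Metric.mem_ball]
    refine φ.finsum_smul_mem_convex (g := fun i _ => p i) (mem_univ x)
      (fun i hi => ?_) (convex_ball _ _)
    have h1 : dist (f x) i < ε / 2 := hVs i (hφV i x hi)
    have h2 := dist_triangle_right (p i) (f x) i
    rw [Metric.mem_ball]
    linarith [hpd i]

/-- Maps from a closed subset to a punctured vector space of dimension larger than the covering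
dimension extend. -/
theorem HasCoveringDimLE.exists_continuous_ne_zero_eqOn [NormalSpace X]
    (h : HasCoveringDimLE X d) (hE : d < Module.finrank ℝ E) {D : Set X} (hD : IsClosed D)
    {f : X → E} (hf : ContinuousOn f D) (hf0 : ∀ x ∈ D, f x ≠ 0) :
    ∃ g : X → E, Continuous g ∧ (∀ x, g x ≠ 0) ∧ EqOn g f D := by
  have hn : ∀ x ∈ D, ‖f x‖ ≠ 0 := fun x hx => norm_ne_zero_iff.2 (hf0 x hx)
  -- Norm and direction are extended separately; passing through the logarithm keeps the extended
  -- norm positive.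
  obtain ⟨l, hlc, hl⟩ := exists_continuous_eqOn_of_isClosed hD (hf.norm.log hn)
  have := Metric.instTietzeExtensionClosedBall.{u, 0, w} ℝ (0 : E) one_pos
  obtain ⟨F, hF1, hF⟩ := ContinuousMap.exists_forall_mem_restrict_eq hD
    (f := ⟨D.domRestrict (fun x => ‖f x‖⁻¹ • f x), ((hf.norm.inv₀ hn).smul hf).domRestrict⟩)
    (t := Metric.closedBall (0 : E) 1) (fun x => by
      have := hn x x.2
      change ‖f x‖⁻¹ • f x ∈ _
      simp [norm_smul, this])
  replace hF : ∀ x ∈ D, F x = ‖f x‖⁻¹ • f x := fun x hx => DFunLike.congr_fun hF ⟨x, hx⟩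
  have hF1 : ∀ x, ‖F x‖ ≤ 1 := fun x => by simpa using hF1 x
  obtain ⟨G, hGc, hG0, hG⟩ := h.exists_continuous_ne_zero_dist_lt hE F.continuous
    (isBounded_iff_forall_norm_le.2 ⟨1, by rintro _ ⟨x, rfl⟩; exact hF1 x⟩)
    (ε := 1 / 2) (by norm_num)
  -- The cutoff is 1 where `‖F x‖ = 1`, in particular on `D`, so `F` is unchanged there; it is 0
  -- where `‖F x‖ ≤ 1 / 2`, so `F` is replaced by `G`. In between, the correction is shorter than `1
  -- / 2 ≤ ‖F x‖` and cannot cancel `F`.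
  set c : X → ℝ := fun x => max 0 (2 * ‖F x‖ - 1)
  have hc0 : ∀ x, 0 ≤ c x := fun x => le_max_left _ _
  have hc1 : ∀ x, c x ≤ 1 := fun x => max_le zero_le_one (by linarith [hF1 x])
  refine ⟨fun x => Real.exp (l x) • (F x + (1 - c x) • (G x - F x)), by fun_prop,
    fun x hx => ?_, fun x hx => ?_⟩
  · have hx := (smul_eq_zero.1 hx).resolve_left (Real.exp_pos _).ne'
    rcases le_total ‖F x‖ (1 / 2) with hle | hle
    · have : c x = 0 := max_eq_left (by linarith)
      rw [this] at hx
      exact hG0 x (by simpa using hx)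
    · have h1 : ‖F x‖ = (1 - c x) * ‖G x - F x‖ := by
        have h3 := congrArg norm (eq_neg_of_add_eq_zero_left hx)
        rwa [norm_neg, norm_smul, Real.norm_of_nonneg (by linarith [hc1 x])] at h3
      have h2 : ‖G x - F x‖ < 1 / 2 := by simpa [dist_eq_norm] using hG x
      nlinarith [norm_nonneg (G x - F x), hc0 x, hc1 x]
  · have h1 : ‖F x‖ = 1 := by
      rw [hF x hx, norm_smul, norm_inv, norm_norm, inv_mul_cancel₀ (hn x hx)]
    have h2 : c x = 1 := by simp only [c, h1]; norm_num
    simp only [h2, sub_self, zero_smul, add_zero]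
    rw [hl hx, Real.exp_log (norm_pos_iff.2 (hf0 x hx)), hF x hx, smul_smul,
      mul_inv_cancel₀ (hn x hx), one_smul]

end CoveringDimension

/-! ### Linear charts adapted to a trivial subbundle -/

section LinearCharts

variable {X : Type u} [TopologicalSpace X] (E : X → Type v)
  [∀ x, AddCommGroup (E x)] [∀ x, Module ℂ (E x)] [TopologicalSpace (Σ x, E x)]

/-- A fiberwise linear identification, over an open set `U`, of a family `E` of vector spaces with
the product `U × F`, as a pair of families of linear maps (with no conditions outside `U`). -/
structure LinearChart (F : Type*) [AddCommGroup F] [Module ℂ F] [TopologicalSpace F]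
    (U : Set X) where
  isOpen_base : IsOpen U
  coord : ∀ x, E x →ₗ[ℂ] F
  vec : ∀ x, F →ₗ[ℂ] E x
  vec_coord : ∀ x ∈ U, ∀ v, vec x (coord x v) = v
  coord_vec : ∀ x ∈ U, ∀ c, coord x (vec x c) = c
  continuousOn_coord :
    ContinuousOn (fun p : Σ x, E x => coord p.1 p.2) (Sigma.fst ⁻¹' U)
  continuousOn_vec :
    ContinuousOn (fun q : X × F => (⟨q.1, vec q.1 q.2⟩ : Σ x, E x)) (Prod.fst ⁻¹' U)

variable {E}

namespace LinearChart

variable {F : Type*} [AddCommGroup F] [Module ℂ F] [TopologicalSpace F] {U : Set X}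

/-- The linear equivalence on the fiber over a point of the base of a chart. -/
def fiberEquiv (L : LinearChart E F U) (x : X) (hx : x ∈ U) : E x ≃ₗ[ℂ] F :=
  { L.coord x with
    invFun := L.vec x
    left_inv := L.vec_coord x hx
    right_inv := L.coord_vec x hx }

theorem coord_injective (L : LinearChart E F U) {x : X} (hx : x ∈ U) :
    Function.Injective (L.coord x) :=
  (L.fiberEquiv x hx).injective

theorem isTrivialBundleOn {n : ℕ} (L : LinearChart E (Fin n → ℂ) U)
    (hπ : Continuous (Sigma.fst : (Σ x, E x) → X)) : IsTrivialBundleOn E U := by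
  refine ⟨n,
    { toFun := fun p => (p.1, L.coord p.1 p.2)
      invFun := fun q => ⟨q.1, L.vec q.1 q.2⟩
      source := Sigma.fst ⁻¹' U
      target := U ×ˢ univ
      map_source' := fun p hp => ⟨hp, mem_univ _⟩
      map_target' := fun q hq => hq.1
      left_inv' := fun p hp => by simp [L.vec_coord p.1 hp]
      right_inv' := fun q hq => by simp [L.coord_vec q.1 hq.1]
      open_source := L.isOpen_base.preimage hπ
      open_target := L.isOpen_base.prod isOpen_univ
      continuousOn_toFun := hπ.continuousOn.prodMk L.continuousOn_coord
      continuousOn_invFun := L.continuousOn_vec.mono fun q hq => hq.1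
      baseSet := U
      open_baseSet := L.isOpen_base
      source_eq := rfl
      target_eq := rfl
      proj_toFun := fun p _ => rfl }, rfl, fun x _ => (L.coord x).isLinear⟩

/-- Change of chart by a family of linear maps, over the set where they are invertible. -/
theorem exists_reframe {F G : Type*} [NormedAddCommGroup F] [NormedSpace ℂ F]
    [NormedAddCommGroup G] [NormedSpace ℂ G] [CompleteSpace G]
    (hπ : Continuous (Sigma.fst : (Σ x, E x) → X)) (L : LinearChart E F U)
    (B : X → G →L[ℂ] F) (hB : ContinuousOn B U) :
    ∃ L' : LinearChart E G (U ∩ B ⁻¹' range ((↑) : (G ≃L[ℂ] F) → G →L[ℂ] F)),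
      ∀ x, ∀ c, L'.vec x c = L.vec x (B x c) := by
  refine ⟨{ isOpen_base := hB.isOpen_inter_preimage L.isOpen_base ContinuousLinearEquiv.isOpen
            coord := fun x => (B x).inverse.toLinearMap ∘ₗ L.coord x
            vec := fun x => L.vec x ∘ₗ (B x).toLinearMap
            vec_coord := ?_
            coord_vec := ?_
            continuousOn_coord := ?_
            continuousOn_vec := ?_ }, fun x c => rfl⟩
  · rintro x ⟨hx, e, he⟩ v
    simp [← he, L.vec_coord x hx]
  · rintro x ⟨hx, e, he⟩ c
    simp [← he, L.coord_vec x hx]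
  · refine ContinuousOn.clm_apply (f := fun p : Σ x, E x => (B p.1).inverse) ?_
      (L.continuousOn_coord.mono fun p hp => hp.1)
    rintro p ⟨hp, e, he⟩
    -- Inversion is continuous at invertible operators, the only ones occurring over the new base.
    have h1 : ContinuousAt ContinuousLinearMap.inverse (B p.1) :=
      he ▸ (contDiffAt_map_inverse (n := 0) e).continuousAt
    exact h1.comp_continuousWithinAt (f := fun p : Σ x, E x => B p.1)
      ((hB p.1 hp).comp (f := Sigma.fst) hπ.continuousWithinAt fun q hq => hq.1)
  · refine L.continuousOn_vec.comp (f := fun q : X × G => (q.1, B q.1 q.2)) ?_ fun q hq => hq.1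
    exact continuousOn_fst.prodMk ((hB.comp continuousOn_fst fun q hq => hq.1).clm_apply
      continuousOn_snd)

end LinearChart

theorem IsTrivialBundleOn.exists_linearChart {U : Set X} (h : IsTrivialBundleOn E U) :
    ∃ n : ℕ, Nonempty (LinearChart E (Fin n → ℂ) U) := by
  classical
  obtain ⟨n, e, rfl, hlin⟩ := h
  have hbij : ∀ x ∈ e.baseSet, Function.Bijective (fun v : E x => (e ⟨x, v⟩).2) := by
    refine fun x hx => ⟨fun v w hvw => ?_, fun c => ?_⟩
    · have hv : (⟨x, v⟩ : Σ x, E x) ∈ e.source := e.mem_source.2 hx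
      have hw : (⟨x, w⟩ : Σ x, E x) ∈ e.source := e.mem_source.2 hx
      have := e.injOn hv hw (Prod.ext ((e.coe_fst hv).trans (e.coe_fst hw).symm) hvw)
      simpa using this
    · have hc : (x, c) ∈ e.target := e.mem_target.2 hx
      have h1 := e.proj_symm_apply hc
      have h2 := e.apply_symm_apply hc
      -- The base point of the preimage equals `x` only propositionally; generalizing allows
      -- substitution.
      generalize e.toOpenPartialHomeomorph.symm (x, c) = p at h1 h2
      obtain ⟨y, v⟩ := p
      obtain rfl : y = x := h1
      exact ⟨v, by simp [h2]⟩
  let A : ∀ x (hx : x ∈ e.baseSet), E x ≃ₗ[ℂ] (Fin n → ℂ) := fun x hx =>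
    LinearEquiv.ofBijective (hlin x hx).mk' (hbij x hx)
  have hA : ∀ x (hx : x ∈ e.baseSet) v, A x hx v = (e ⟨x, v⟩).2 := fun x hx v => rfl
  refine ⟨n, ⟨{
    isOpen_base := e.open_baseSet
    coord := fun x => if hx : x ∈ e.baseSet then (A x hx).toLinearMap else 0
    vec := fun x => if hx : x ∈ e.baseSet then (A x hx).symm.toLinearMap else 0
    vec_coord := fun x hx v => by simp [hx]
    coord_vec := fun x hx v => by simp [hx]
    continuousOn_coord := ?_
    continuousOn_vec := ?_ }⟩⟩
  · refine (continuous_snd.comp_continuousOn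
      e.toOpenPartialHomeomorph.continuousOn).congr_mono ?_ e.source_eq.ge
    intro p hp
    have hp' : p.1 ∈ e.baseSet := hp
    simp [hp', hA]
  · refine e.toOpenPartialHomeomorph.continuousOn_symm.congr_mono ?_
      fun q hq => e.mem_target.2 hq
    intro q hq
    have hq' : q.1 ∈ e.baseSet := hq
    have hs : (⟨q.1, (A q.1 hq').symm q.2⟩ : Σ x, E x) ∈ e.source := e.mem_source.2 hq'
    simp only [hq', dif_pos, LinearEquiv.coe_coe]
    refine (e.toOpenPartialHomeomorph.left_inv hs).symm.trans (congrArg _ (Prod.ext ?_ ?_))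
    · exact e.coe_fst hs
    · exact (hA _ hq' _).symm.trans (LinearEquiv.apply_symm_apply _ _)

theorem continuous_sigma_fst_of_isTrivialBundleOn
    (h : ∀ x : X, ∃ U : Set X, x ∈ U ∧ IsTrivialBundleOn E U) :
    Continuous (Sigma.fst : (Σ x, E x) → X) := by
  refine continuous_iff_continuousAt.2 fun p => ?_
  obtain ⟨_, hp, n, e, rfl, -⟩ := h p.1
  exact e.continuousAt_proj (e.mem_source.2 hp)

/-- Any subspace of `ℂⁿ` has a complement spanned by standard basis vectors. -/
theorem exists_bijective_coprod_single {n k : ℕ} (A : (Fin k → ℂ) →ₗ[ℂ] (Fin n → ℂ))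
    (hA : Function.Injective A) : ∃ ι : Fin (n - k) → Fin n,
      Function.Bijective (A.coprod
        (Fintype.linearCombination ℂ fun l => (Pi.single (ι l) 1 : Fin n → ℂ))) := by
  have hk : Module.finrank ℂ (LinearMap.range A) = k := by
    rw [LinearMap.finrank_range_of_inj hA, Module.finrank_fin_fun]
  have hkn : k ≤ n := by simpa using LinearMap.finrank_le_finrank_of_injective hA
  set q := (LinearMap.range A).mkQ
  -- The classes of the standard basis vectors span the quotient by the range of `A`, so some of
  -- them form a basis of it.
  obtain ⟨κ, a, ha, hspan, hind⟩ := exists_linearIndependent' ℂ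
    (fun i : Fin n => q (Pi.single i 1))
  have htop : Submodule.span ℂ (range fun i : Fin n => q (Pi.single i 1)) = ⊤ := by
    have h1 := (Pi.basisFun ℂ (Fin n)).span_eq
    have h2 : (range fun i : Fin n => q (Pi.single i 1)) = q '' range (Pi.basisFun ℂ (Fin n)) := by
      rw [← range_comp]; congr 1; ext i; simp
    rw [h2, Submodule.span_image, h1, Submodule.map_top, Submodule.range_mkQ]
  have := Finite.of_injective a ha
  have := Fintype.ofFinite κ
  have hcard : Fintype.card κ = n - k := by
    rw [← finrank_span_eq_card hind, hspan, htop, finrank_top]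
    have := (LinearMap.range A).finrank_quotient_add_finrank
    rw [hk, Module.finrank_fin_fun] at this
    omega
  let eκ : Fin (n - k) ≃ κ := (Fintype.equivFinOfCardEq hcard).symm
  refine ⟨a ∘ eκ, ?_⟩
  suffices h : Function.Injective (A.coprod
      (Fintype.linearCombination ℂ fun l => (Pi.single ((a ∘ eκ) l) 1 : Fin n → ℂ))) by
    refine ⟨h, (LinearMap.injective_iff_surjective_of_finrank_eq_finrank ?_).1 h⟩
    simp only [Module.finrank_prod, Module.finrank_fin_fun]
    omega
  · rw [← LinearMap.ker_eq_bot, LinearMap.ker_eq_bot']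
    rintro ⟨y, c⟩ h
    have hind' := hind.comp eκ eκ.injective
    have hc : c = 0 := by
      have h1 := congrArg q h
      have h2 : q (A y) = 0 := (Submodule.Quotient.mk_eq_zero _).2 ⟨y, rfl⟩
      rw [LinearMap.coprod_apply, map_add, h2, zero_add, Fintype.linearCombination_apply,
        map_sum, map_zero] at h1
      simp only [map_smul] at h1
      exact funext (Fintype.linearIndependent_iff.1 hind' c h1)
    rw [LinearMap.coprod_apply, hc, map_zero, add_zero] at h
    have hy : y = 0 := hA (h.trans A.map_zero.symm)
    rw [hc, hy]
    rfl

/-- A continuous injective map of the trivial bundle with fiber `ℂᵏ` into a family of finite type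
is, over the members of a finite open covering, the inclusion of a factor of a product. -/
theorem exists_adapted_linearCharts (hπ : Continuous (Sigma.fst : (Σ x, E x) → X))
    {𝒰 : Set (Set X)} (h𝒰f : 𝒰.Finite) (h𝒰c : ⋃₀ 𝒰 = univ)
    (h𝒰 : ∀ U ∈ 𝒰, IsTrivialBundleOn E U) {k : ℕ} (σ : ∀ x, (Fin k → ℂ) →ₗ[ℂ] E x)
    (hσ : Continuous fun q : X × (Fin k → ℂ) => (⟨q.1, σ q.1 q.2⟩ : Σ x, E x))
    (hinj : ∀ x, Function.Injective (σ x)) :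
    ∃ (J : Type u) (_ : Finite J) (U : J → Set X) (m : J → ℕ)
      (L : ∀ j, LinearChart E ((Fin k → ℂ) × (Fin (m j) → ℂ)) (U j)),
      ⋃ j, U j = univ ∧ ∀ j, ∀ x ∈ U j, ∀ a, (L j).coord x (σ x a) = (a, 0) := by
  choose! n hn using fun U hU => (h𝒰 U hU).exists_linearChart
  let L₀ : ∀ U : 𝒰, LinearChart E (Fin (n U) → ℂ) U := fun U => (hn U U.2).some
  have := h𝒰f.to_subtype
  -- Complements are sought only among coordinate subspaces. There are finitely many, so the
  -- covering by the open sets where `B₀ j` is invertible remains finite.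
  let B₀ : ∀ j : (Σ U : 𝒰, (Fin (n U - k) → Fin (n U))), X →
      ((Fin k → ℂ) × (Fin (n j.1 - k) → ℂ)) →ₗ[ℂ] (Fin (n j.1) → ℂ) := fun j x =>
    ((L₀ j.1).coord x ∘ₗ σ x).coprod
      (Fintype.linearCombination ℂ fun l => (Pi.single (j.2 l) 1 : Fin (n j.1) → ℂ))
  let B := fun j x => LinearMap.toContinuousLinearMap (B₀ j x)
  have hB : ∀ j, ContinuousOn (B j) j.1 := by
    refine fun j => continuousOn_clm_apply.2 fun y => ?_
    refine ContinuousOn.add ?_ continuousOn_const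
    exact (L₀ j.1).continuousOn_coord.comp (f := fun x => (⟨x, σ x y.1⟩ : Σ x, E x))
      (hσ.comp (continuous_id.prodMk continuous_const)).continuousOn fun x hx => hx
  choose L hL using fun j => (L₀ j.1).exists_reframe hπ (B j) (hB j)
  refine ⟨_, inferInstance, _, _, L, eq_univ_of_forall fun x => ?_, fun j x hx a => ?_⟩
  · obtain ⟨U, hU, hx⟩ := mem_sUnion.1 (h𝒰c.ge (mem_univ x))
    obtain ⟨ι, hι⟩ := exists_bijective_coprod_single ((L₀ ⟨U, hU⟩).coord x ∘ₗ σ x)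
      (((L₀ ⟨U, hU⟩).coord_injective hx).comp (hinj x))
    refine mem_iUnion.2 ⟨⟨⟨U, hU⟩, ι⟩, hx,
      (LinearEquiv.ofBijective _ hι).toContinuousLinearEquiv, ?_⟩
    ext <;> rfl
  · have h1 : (L j).vec x (a, 0) = σ x a := by
      rw [hL]
      change (L₀ j.1).vec x (B₀ j x (a, 0)) = _
      simp only [B₀, LinearMap.coprod_apply, map_zero, add_zero, LinearMap.comp_apply]
      exact (L₀ j.1).vec_coord x hx.1 _
    rw [← h1, (L j).coord_vec x hx]

end LinearCharts

/-! ### Construction of a trivial subbundle -/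

section Monomorphisms

variable {X : Type u} [TopologicalSpace X] {E : X → Type v}
  [∀ x, AddCommGroup (E x)] [∀ x, Module ℂ (E x)] [TopologicalSpace (Σ x, E x)]

namespace LinearChart

variable {F : Type*} [AddCommGroup F] [Module ℂ F] [TopologicalSpace F] {U : Set X}

theorem continuousOn_coord_comp (L : LinearChart E F U) {Z : Type*} [TopologicalSpace Z]
    {S : Set Z} {f : Z → X} {w : ∀ z, E (f z)}
    (hw : ContinuousOn (fun z => (⟨f z, w z⟩ : Σ x, E x)) S) (hS : MapsTo f S U) :
    ContinuousOn (fun z => L.coord (f z) (w z)) S :=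
  L.continuousOn_coord.comp hw hS

theorem continuousOn_of_coord (L : LinearChart E F U) {Z : Type*} [TopologicalSpace Z]
    {S : Set Z} {f : Z → X} {w : ∀ z, E (f z)} (hf : ContinuousOn f S) (hS : MapsTo f S U)
    (hw : ContinuousOn (fun z => L.coord (f z) (w z)) S) :
    ContinuousOn (fun z => (⟨f z, w z⟩ : Σ x, E x)) S := by
  refine (L.continuousOn_vec.comp (hf.prodMk hw) hS).congr fun z hz => ?_
  simp [L.vec_coord _ (hS hz)]

end LinearChart

/-- In a local chart the fiberwise operations become those of `ℂⁿ`. -/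
theorem continuous_add_smul (h : ∀ x : X, ∃ U : Set X, x ∈ U ∧ IsTrivialBundleOn E U)
    {Z : Type*} [TopologicalSpace Z] {f : Z → X} {w₁ w₂ : ∀ z, E (f z)} {c : Z → ℂ}
    (h₁ : Continuous fun z => (⟨f z, w₁ z⟩ : Σ x, E x))
    (h₂ : Continuous fun z => (⟨f z, w₂ z⟩ : Σ x, E x)) (hc : Continuous c) :
    Continuous fun z => (⟨f z, w₁ z + c z • w₂ z⟩ : Σ x, E x) := by
  have hf : Continuous f := (continuous_sigma_fst_of_isTrivialBundleOn h).comp h₁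
  refine continuous_iff_continuousAt.2 fun z => ?_
  obtain ⟨U, hz, hU⟩ := h (f z)
  obtain ⟨n, ⟨L⟩⟩ := hU.exists_linearChart
  refine ContinuousOn.continuousAt (s := f ⁻¹' U) ?_ ((L.isOpen_base.preimage hf).mem_nhds hz)
  refine L.continuousOn_of_coord hf.continuousOn (mapsTo_preimage f U) ?_
  simp only [map_add, map_smul]
  exact (L.continuousOn_coord_comp h₁.continuousOn (mapsTo_preimage f U)).add
    (hc.continuousOn.smul (L.continuousOn_coord_comp h₂.continuousOn (mapsTo_preimage f U)))

/-- Over a normal space of covering dimension less than the real corank of the image, the image of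
a monomorphism from a trivial bundle is avoided by some section. -/
theorem exists_continuous_section_notMem_range [NormalSpace X] {d : ℕ}
    (hdim : HasCoveringDimLE X d) (hπ : Continuous (Sigma.fst : (Σ x, E x) → X))
    {𝒰 : Set (Set X)} (h𝒰f : 𝒰.Finite) (h𝒰c : ⋃₀ 𝒰 = univ)
    (h𝒰 : ∀ U ∈ 𝒰, IsTrivialBundleOn E U) {k : ℕ} (σ : ∀ x, (Fin k → ℂ) →ₗ[ℂ] E x)
    (hσ : Continuous fun q : X × (Fin k → ℂ) => (⟨q.1, σ q.1 q.2⟩ : Σ x, E x))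
    (hinj : ∀ x, Function.Injective (σ x))
    (hrank : ∀ x, d + 2 * k < 2 * Module.finrank ℂ (E x)) :
    ∃ t : ∀ x, E x, Continuous (fun x => (⟨x, t x⟩ : Σ x, E x)) ∧
      ∀ x, t x ∉ LinearMap.range (σ x) := by
  classical
  obtain ⟨J, _, U, m, L, hU, hL⟩ := exists_adapted_linearCharts hπ h𝒰f h𝒰c h𝒰 σ hσ hinj
  have := Fintype.ofFinite J
  have hmem : ∀ j, ∀ x ∈ U j, ∀ v, v ∈ LinearMap.range (σ x) ↔ ((L j).coord x v).2 = 0 := by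
    intro j x hx v
    constructor
    · rintro ⟨a, rfl⟩
      rw [hL j x hx]
    · intro h
      refine ⟨((L j).coord x v).1, (L j).coord_injective hx ?_⟩
      rw [hL j x hx, ← h]
  -- By normality the charts shrink to closed pieces, over which the section is extended one piece
  -- at a time.
  obtain ⟨C, hC, hCc, hCU⟩ := exists_iUnion_eq_closed_subset
    (fun j => (L j).isOpen_base) (fun x => Set.toFinite _) hU
  suffices H : ∀ T : Finset J, ∃ t : ∀ x, E x,
      ContinuousOn (fun x => (⟨x, t x⟩ : Σ x, E x)) (⋃ j ∈ T, C j) ∧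
      ∀ x ∈ ⋃ j ∈ T, C j, t x ∉ LinearMap.range (σ x) by
    obtain ⟨t, h1, h2⟩ := H Finset.univ
    simp only [Finset.mem_univ, iUnion_true, hC] at h1 h2
    exact ⟨t, continuousOn_univ.1 h1, fun x => h2 x (mem_univ x)⟩
  intro T
  induction T using Finset.induction_on with
  | empty => exact ⟨fun x => 0, by simp, by simp⟩
  | insert j T hj ih =>
    obtain ⟨t, htc, ht⟩ := ih
    set A := ⋃ j ∈ T, C j
    have hA : IsClosed A := T.finite_toSet.isClosed_biUnion fun j _ => hCc j
    have hD : IsClosed (C j ∩ A) := (hCc j).inter hA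
    rw [Finset.set_biUnion_insert]
    -- The bound on `m j` comes from the rank of a fiber over `U j`, so a point is needed.
    rcases (U j).eq_empty_or_nonempty with hem | ⟨x₀, hx₀⟩
    · rw [subset_eq_empty (hCU j) hem, empty_union]
      exact ⟨t, htc, ht⟩
    have hm : d < Module.finrank ℝ (Fin (m j) → ℂ) := by
      have h1 := ((L j).fiberEquiv x₀ hx₀).finrank_eq
      have h2 := hrank x₀
      rw [Module.finrank_prod, Module.finrank_fin_fun, Module.finrank_fin_fun] at h1
      rw [finrank_real_of_complex, Module.finrank_fin_fun]
      omega
    have hcoord : ContinuousOn (fun x => (L j).coord x (t x)) (C j ∩ A) :=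
      (L j).continuousOn_coord_comp (htc.mono inter_subset_right) fun x hx => hCU j hx.1
    -- Only the component transverse to the range of `σ` has to stay nonzero; the other one extends
    -- by Tietze.
    obtain ⟨g₂, hg₂c, hg₂, hg₂t⟩ := hdim.exists_continuous_ne_zero_eqOn hm hD hcoord.snd
      fun x hx => (hmem j x (hCU j hx.1) (t x)).not.1 (ht x hx.2)
    obtain ⟨g₁, hg₁c, hg₁t⟩ := exists_continuous_eqOn_of_isClosed hD hcoord.fst
    have hnew : ∀ x ∈ C j, (if x ∈ A then t x else (L j).vec x (g₁ x, g₂ x)) =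
        (L j).vec x (g₁ x, g₂ x) := by
      intro x hx
      split_ifs with hxA
      · rw [hg₁t ⟨hx, hxA⟩, hg₂t ⟨hx, hxA⟩]
        exact ((L j).vec_coord x (hCU j hx) (t x)).symm
      · rfl
    refine ⟨fun x => if x ∈ A then t x else (L j).vec x (g₁ x, g₂ x), ?_, ?_⟩
    · refine ContinuousOn.union_of_isClosed ?_ ?_ (hCc j) hA
      · refine ((L j).continuousOn_vec.comp (f := fun x => (x, (g₁ x, g₂ x))) (by fun_prop)
          (hCU j)).congr fun x hx => ?_
        simp only [Function.comp_apply, hnew x hx]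
      · refine htc.congr fun x hx => ?_
        beta_reduce
        rw [if_pos hx]
    · rintro x (hx | hx)
      · simp only [hnew x hx]
        rw [hmem j x (hCU j hx), (L j).coord_vec x (hCU j hx)]
        exact hg₂ x
      · beta_reduce
        rw [if_pos hx]
        exact ht x hx

/-- Over a normal space of covering dimension `d`, a bundle of finite type whose fibers all have
rank at least `k + γ`, with `d ≤ 2γ + 1`, contains a trivial subbundle of rank `k`. -/
theorem exists_trivial_subbundle [NormalSpace X] {d γ : ℕ}
    (hdim : HasCoveringDimLE X d) (hdγ : d ≤ 2 * γ + 1)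
    {𝒰 : Set (Set X)} (h𝒰f : 𝒰.Finite) (h𝒰c : ⋃₀ 𝒰 = univ)
    (h𝒰 : ∀ U ∈ 𝒰, IsTrivialBundleOn E U) (k : ℕ)
    (hrank : ∀ x, k + γ ≤ Module.finrank ℂ (E x)) :
    ∃ σ : ∀ x, (Fin k → ℂ) →ₗ[ℂ] E x,
      (Continuous fun q : X × (Fin k → ℂ) => (⟨q.1, σ q.1 q.2⟩ : Σ x, E x)) ∧
      ∀ x, Function.Injective (σ x) := by
  have hloc : ∀ x : X, ∃ U : Set X, x ∈ U ∧ IsTrivialBundleOn E U := fun x => by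
    obtain ⟨U, hU, hx⟩ := mem_sUnion.1 (h𝒰c.ge (mem_univ x))
    exact ⟨U, hx, h𝒰 U hU⟩
  have hπ := continuous_sigma_fst_of_isTrivialBundleOn hloc
  induction k with
  | zero =>
    refine ⟨fun x => 0, ?_, fun x => Function.injective_of_subsingleton _⟩
    refine continuous_iff_continuousAt.2 fun q => ?_
    obtain ⟨U, hx, hU⟩ := hloc q.1
    obtain ⟨n, ⟨L⟩⟩ := hU.exists_linearChart
    refine ContinuousOn.continuousAt (s := Prod.fst ⁻¹' U) ?_
      ((L.isOpen_base.preimage continuous_fst).mem_nhds hx)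
    exact L.continuousOn_of_coord continuousOn_fst (mapsTo_preimage _ U)
      (by simpa using continuousOn_const)
  | succ k ih =>
    obtain ⟨σ, hσ, hinj⟩ := ih fun x => by have := hrank x; omega
    obtain ⟨t, htc, ht⟩ := exists_continuous_section_notMem_range hdim hπ h𝒰f h𝒰c h𝒰 σ hσ hinj
      fun x => by have := hrank x; omega
    -- The new section becomes the image of basis vector 0, and the old frame is shifted by one.
    refine ⟨fun x => σ x ∘ₗ LinearMap.funLeft ℂ ℂ Fin.succ +
      (LinearMap.proj 0).smulRight (t x), ?_, fun x => ?_⟩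
    · exact continuous_add_smul hloc
        (hσ.comp (f := fun q : X × (Fin (k + 1) → ℂ) => (q.1, fun i => q.2 i.succ)) (by fun_prop))
        (htc.comp continuous_fst) (c := fun q => q.2 0) (by fun_prop)
    · rw [← LinearMap.ker_eq_bot, LinearMap.ker_eq_bot']
      intro a ha
      have ha : σ x (fun i => a i.succ) + a 0 • t x = 0 := ha
      have h0 : a 0 = 0 := by
        by_contra h0
        refine ht x ⟨-(a 0)⁻¹ • fun i => a i.succ, ?_⟩
        rw [map_smul, eq_neg_of_add_eq_zero_left ha, neg_smul, smul_neg, neg_neg, smul_smul,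
          inv_mul_cancel₀ h0, one_smul]
      rw [h0, zero_smul, add_zero] at ha
      have h1 := hinj x (ha.trans (map_zero _).symm)
      funext i
      refine Fin.cases h0 (fun i => congrFun h1 i) i

end Monomorphisms

/-! ### Splitting off the trivial subbundle -/

section Splitting

variable {X : Type u} [TopologicalSpace X] {E : X → Type v}
  [∀ x, AddCommGroup (E x)] [∀ x, Module ℂ (E x)] [TopologicalSpace (Σ x, E x)]

/-- Over a normal space, a monomorphism from a trivial bundle to a bundle of finite type has a
retraction. -/
theorem exists_retraction [NormalSpace X] (hπ : Continuous (Sigma.fst : (Σ x, E x) → X))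
    {k : ℕ} (σ : ∀ x, (Fin k → ℂ) →ₗ[ℂ] E x) {J : Type*} [Finite J] {U : J → Set X} {m : J → ℕ}
    (L : ∀ j, LinearChart E ((Fin k → ℂ) × (Fin (m j) → ℂ)) (U j)) (hU : ⋃ j, U j = univ)
    (hL : ∀ j, ∀ x ∈ U j, ∀ a, (L j).coord x (σ x a) = (a, 0)) :
    ∃ ρ : ∀ x, E x →ₗ[ℂ] (Fin k → ℂ),
      (Continuous fun p : Σ x, E x => ρ p.1 p.2) ∧ ∀ x a, ρ x (σ x a) = a := by
  have := Fintype.ofFinite J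
  obtain ⟨φ, hφ⟩ := PartitionOfUnity.exists_isSubordinate_of_locallyFinite isClosed_univ U
    (fun j => (L j).isOpen_base) (locallyFinite_of_finite U) hU.ge
  -- The first chart component is a local retraction, and a convex combination of retractions is a
  -- retraction.
  refine ⟨fun x => ∑ j, (φ j x : ℂ) • (LinearMap.fst ℂ _ _ ∘ₗ (L j).coord x), ?_, fun x a => ?_⟩
  · simp only [LinearMap.sum_apply, LinearMap.smul_apply, LinearMap.comp_apply,
      LinearMap.fst_apply]
    refine continuous_finsetSum _ fun j _ => continuous_iff_continuousAt.2 fun p => ?_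
    by_cases hp : p.1 ∈ U j
    · have h1 := (L j).continuousOn_coord.continuousAt
        (((L j).isOpen_base.preimage hπ).mem_nhds hp)
      have h2 : Continuous fun p : Σ x, E x => (φ j p.1 : ℂ) :=
        Complex.continuous_ofReal.comp ((φ j).continuous.comp hπ)
      exact h2.continuousAt.smul h1.fst
    -- Off `U j` the chart is uncontrolled, but there the term vanishes on a neighborhood.
    · have h1 : ∀ᶠ x in 𝓝 p.1, φ j x = 0 :=
        notMem_tsupport_iff_eventuallyEq.1 fun h => hp (hφ j h)
      refine (continuousAt_const (y := (0 : Fin k → ℂ))).congr ?_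
      filter_upwards [hπ.continuousAt.eventually h1] with q hq
      simp [hq]
  · have h1 : ∀ j, (φ j x : ℂ) • ((L j).coord x (σ x a)).1 = (φ j x : ℂ) • a := fun j => by
      by_cases hx : x ∈ U j
      · rw [hL j x hx]
      · have : φ j x = 0 := by
          by_contra h
          exact hx (hφ j (subset_tsupport _ h))
        simp [this]
    have h2 : ∑ j, φ j x = 1 := by
      rw [← finsum_eq_sum_of_fintype]
      exact φ.sum_eq_one (mem_univ x)
    simp only [LinearMap.sum_apply, LinearMap.smul_apply, LinearMap.comp_apply,
      LinearMap.fst_apply, h1, ← Finset.sum_smul]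
    rw [← Complex.ofReal_sum, h2, Complex.ofReal_one, one_smul]

variable {k : ℕ} {ρ : ∀ x, E x →ₗ[ℂ] (Fin k → ℂ)} {σ : ∀ x, (Fin k → ℂ) →ₗ[ℂ] E x}

/-- The total space of the kernel of a family of linear maps, as a subspace. -/
instance kernelTopology : TopologicalSpace (Σ x, LinearMap.ker (ρ x)) :=
  .induced (fun p => (⟨p.1, p.2⟩ : Σ x, E x)) inferInstance

theorem continuous_kernel_inclusion :
    Continuous fun p : Σ x, LinearMap.ker (ρ x) => (⟨p.1, p.2⟩ : Σ x, E x) :=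
  continuous_induced_dom

/-- The projection to the kernel of a family of linear maps given by a section of it. -/
def kernelProjection (hσρ : ∀ x a, ρ x (σ x a) = a) (x : X) : E x →ₗ[ℂ] LinearMap.ker (ρ x) :=
  (LinearMap.id - σ x ∘ₗ ρ x).codRestrict _ fun v => by simp [hσρ]

theorem coe_kernelProjection (hσρ : ∀ x a, ρ x (σ x a) = a) (x : X) (v : E x) :
    (kernelProjection hσρ x v : E x) = v - σ x (ρ x v) :=
  rfl

theorem continuous_kernelProjection
    (h : ∀ x : X, ∃ U : Set X, x ∈ U ∧ IsTrivialBundleOn E U)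
    (hρ : Continuous fun p : Σ x, E x => ρ p.1 p.2)
    (hσ : Continuous fun q : X × (Fin k → ℂ) => (⟨q.1, σ q.1 q.2⟩ : Σ x, E x))
    (hσρ : ∀ x a, ρ x (σ x a) = a) :
    Continuous fun p : Σ x, E x =>
      (⟨p.1, kernelProjection hσρ p.1 p.2⟩ : Σ x, LinearMap.ker (ρ x)) := by
  refine continuous_induced_rng.2 ?_
  have hπ := continuous_sigma_fst_of_isTrivialBundleOn h
  refine (continuous_add_smul h continuous_id (hσ.comp (hπ.prodMk hρ))
    (continuous_const (y := (-1 : ℂ)))).congr fun p => ?_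
  simp [coe_kernelProjection, sub_eq_add_neg]

/-- In the chart the range of `σ` is `ℂᵏ × 0`. Both `ker ρ` and `0 × ℂᵐ` are complements of it, so
projecting along it identifies them. -/
theorem isTrivialBundleOn_kernel
    (h : ∀ x : X, ∃ U : Set X, x ∈ U ∧ IsTrivialBundleOn E U)
    (hρ : Continuous fun p : Σ x, E x => ρ p.1 p.2)
    (hσ : Continuous fun q : X × (Fin k → ℂ) => (⟨q.1, σ q.1 q.2⟩ : Σ x, E x))
    (hσρ : ∀ x a, ρ x (σ x a) = a) {m : ℕ} {U : Set X}
    (L : LinearChart E ((Fin k → ℂ) × (Fin m → ℂ)) U)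
    (hL : ∀ x ∈ U, ∀ a, L.coord x (σ x a) = (a, 0)) :
    IsTrivialBundleOn (fun x => LinearMap.ker (ρ x)) U := by
  let L' : LinearChart (fun x => LinearMap.ker (ρ x)) (Fin m → ℂ) U :=
    { isOpen_base := L.isOpen_base
      coord := fun x => LinearMap.snd ℂ _ _ ∘ₗ L.coord x ∘ₗ (LinearMap.ker (ρ x)).subtype
      vec := fun x => kernelProjection hσρ x ∘ₗ L.vec x ∘ₗ LinearMap.inr ℂ _ _
      vec_coord := fun x hx w => by
        have h1 : L.vec x (0, (L.coord x w).2) = w - σ x (L.coord x w).1 := by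
          refine L.coord_injective hx ?_
          rw [L.coord_vec x hx, map_sub, hL x hx]
          ext <;> simp
        have h2 : ρ x w = 0 := w.2
        refine Subtype.ext ?_
        change L.vec x (0, (L.coord x w).2) - σ x (ρ x (L.vec x (0, (L.coord x w).2))) = w
        rw [h1, map_sub, h2, hσρ, zero_sub, map_neg]
        abel
      coord_vec := fun x hx c => by
        change (L.coord x (L.vec x (0, c) - σ x (ρ x (L.vec x (0, c))))).2 = c
        rw [map_sub, L.coord_vec x hx, hL x hx]
        simp
      continuousOn_coord := continuous_snd.comp_continuousOn
        (L.continuousOn_coord.comp continuous_kernel_inclusion.continuousOn fun p hp => hp)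
      continuousOn_vec := (continuous_kernelProjection h hρ hσ hσρ).comp_continuousOn
        (L.continuousOn_vec.comp (f := fun q : X × (Fin m → ℂ) => (q.1, ((0 : Fin k → ℂ), q.2)))
          (by fun_prop) fun q hq => hq) }
  exact L'.isTrivialBundleOn
    ((continuous_sigma_fst_of_isTrivialBundleOn h).comp continuous_kernel_inclusion)

end Splitting

/-! ### The direct sum decomposition and the main theorem -/

/-- A bundle with a split monomorphism from a trivial bundle has a trivial summand. -/
theorem ComplexVectorBundle.hasTrivialSummand_of_retraction {X : Type u} [TopologicalSpace X]
    (ξ : ComplexVectorBundle.{u, v} X) {k : ℕ} (ρ : ∀ x, ξ.Fiber x →ₗ[ℂ] (Fin k → ℂ))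
    (σ : ∀ x, (Fin k → ℂ) →ₗ[ℂ] ξ.Fiber x)
    (hρ : Continuous fun p : ξ.Total => ρ p.1 p.2)
    (hσ : Continuous fun q : X × (Fin k → ℂ) => ξ.point q.1 (σ q.1 q.2))
    (hσρ : ∀ x a, ρ x (σ x a) = a)
    (hker : letI := ξ.topTotal
      ∀ x, ∃ U, x ∈ U ∧ IsTrivialBundleOn (fun x => LinearMap.ker (ρ x)) U) :
    ξ.HasTrivialSummand k := by
  let := ξ.topTotal
  let η : ComplexVectorBundle.{u, v} X :=
    { Fiber := fun x => LinearMap.ker (ρ x)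
      locallyTrivial := hker }
  let φ : ∀ x, ξ.Fiber x ≃ₗ[ℂ] (Fin k → ℂ) × η.Fiber x := fun x =>
    { (ρ x).prod (kernelProjection hσρ x) with
      -- The scalar 1 gives the form required by `continuous_add_smul`.
      invFun := fun q => q.2.1 + (1 : ℂ) • σ x q.1
      left_inv := fun v => by
        change (v - σ x (ρ x v)) + (1 : ℂ) • σ x (ρ x v) = v
        simp
      right_inv := fun q => by
        have h1 : ρ x q.2.1 = 0 := q.2.2
        refine Prod.ext ?_ (Subtype.ext ?_)
        · change ρ x (q.2.1 + (1 : ℂ) • σ x q.1) = q.1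
          simp [hσρ, h1]
        · change (q.2.1 + (1 : ℂ) • σ x q.1) - σ x (ρ x (q.2.1 + (1 : ℂ) • σ x q.1)) = q.2.1
          simp [hσρ, h1] }
  let Φ : ξ.Total ≃ₜ (Fin k → ℂ) × η.Total :=
    { toFun := fun p => ((φ p.1 p.2).1, η.point p.1 (φ p.1 p.2).2)
      invFun := fun q => ξ.point q.2.1 ((φ q.2.1).symm (q.1, q.2.2))
      left_inv := fun p => by
        obtain ⟨x, v⟩ := p
        exact congrArg (ξ.point x) ((φ x).symm_apply_apply v)
      right_inv := fun q => by
        obtain ⟨a, x, w⟩ := q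
        have h := (φ x).apply_symm_apply (a, w)
        exact congrArg (fun q : _ × η.Fiber x => (q.1, η.point x q.2)) h
      continuous_toFun := hρ.prodMk (continuous_kernelProjection ξ.locallyTrivial hρ hσ hσρ)
      continuous_invFun := by
        have hj := continuous_kernel_inclusion (ρ := ρ)
        have hπ := (continuous_sigma_fst_of_isTrivialBundleOn ξ.locallyTrivial).comp hj
        exact continuous_add_smul ξ.locallyTrivial
          (Z := (Fin k → ℂ) × (Σ x, LinearMap.ker (ρ x)))
          (hj.comp continuous_snd) (hσ.comp ((hπ.comp continuous_snd).prodMk continuous_fst))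
          continuous_const }
  exact ⟨η, Φ, φ, fun x v => rfl⟩

/-- This inequality is all that the argument needs to know about `γ`. -/
theorem le_two_mul_summandDefect_add_one (d : ℕ) : d ≤ 2 * summandDefect d + 1 := by
  unfold summandDefect
  split_ifs
  · omega
  · omega
  · have h := Nat.le_ceil ((d : ℝ) / 2)
    have : (d : ℝ) ≤ (2 * ⌈(d : ℝ) / 2⌉₊ + 1 : ℕ) := by
      push_cast
      linarith
    exact_mod_cast this

theorem mainTheorem3 (X : Type u) [TopologicalSpace X] [NormalSpace X]
    (d : ℕ) (hd : coveringDim X = (d : ℕ∞))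
    (ξ : ComplexVectorBundle.{u, v} X) (hξ : ξ.IsFiniteType)
    (b : ℕ) (hb : ∀ x : X, b ≤ Module.finrank ℂ (ξ.Fiber x))
    (hbd : summandDefect d + 1 ≤ b) :
    ξ.HasTrivialSummand (b - summandDefect d) ∧
      ∃ s : Fin (b - summandDefect d) → ∀ x : X, ξ.Fiber x,
        (∀ i, ξ.IsSection (s i)) ∧
          ∀ x : X, LinearIndependent ℂ (fun i => s i x) := by
  let := ξ.topTotal
  obtain ⟨𝒰, h𝒰f, -, h𝒰c, h𝒰⟩ := hξ
  set r := b - summandDefect d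
  obtain ⟨σ, hσ, hinj⟩ := exists_trivial_subbundle (hasCoveringDimLE_of_coveringDim_eq hd)
    (le_two_mul_summandDefect_add_one d) h𝒰f h𝒰c h𝒰 r fun x => by have := hb x; omega
  have hπ := continuous_sigma_fst_of_isTrivialBundleOn ξ.locallyTrivial
  -- The same adapted charts yield the retraction and trivialize its kernel.
  obtain ⟨J, _, U, m, L, hU, hL⟩ := exists_adapted_linearCharts hπ h𝒰f h𝒰c h𝒰 σ hσ hinj
  obtain ⟨ρ, hρ, hσρ⟩ := exists_retraction hπ σ L hU hL
  refine ⟨ξ.hasTrivialSummand_of_retraction ρ σ hρ hσ hσρ fun x => ?_,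
    fun i x => σ x (Pi.single i 1), fun i => ?_, fun x => ?_⟩
  · obtain ⟨j, hj⟩ := mem_iUnion.1 (hU.ge (mem_univ x))
    exact ⟨U j, hj, isTrivialBundleOn_kernel ξ.locallyTrivial hρ hσ hσρ (L j) (hL j)⟩
  · exact hσ.comp (continuous_id.prodMk continuous_const)
  · have h := (Pi.basisFun ℂ (Fin r)).linearIndependent.map' (σ x)
      (LinearMap.ker_eq_bot.2 (hinj x))
    simpa [Function.comp_def] using h
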